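/- For integers $k\ge n\ge 1$ let $I(k,n)$ be the set of $n$-tuples $(k_1,\dots,k_n)$ of positive integers with $k_1+\cdots+k_n=k$. For positive integers $s_1,\dots,s_n$ with $s_1>1$ put $$t(s_1,\dots,s_n)=\sum_{\substack{m_1>\cdots>m_n\ge1\\ m_i\ \mathrm{odd}}}\frac1{m_1^{s_1}\cdots m_n^{s_n}},\qquad t^\star(s_1,\dots,s_n)=\sum_{\substack{m_1\ge\cdots\ge m_n\ge1\\ m_i\ \mathrm{odd}}}\frac1{m_1^{s_1}\cdots m_n^{s_n}},$$ and put $t(0)=0$. Let $\zeta$ be the Riemann zeta function, so that $\zeta(0)=-\tfrac12$. Let $n\ge1$, let $f\in\mathbb{Q}[x_1,\dots,x_n]$ be a symmetric polynomial of degree $r$ (with $r=0$ if $f=0$), and let $$T=\max\left\{\left\lfloor\frac{r+n-2}2\right\rfloor,\left\lfloor\frac{n-1}2\right\rfloor\right\}.$$ Then there are polynomials $c_{f,l},c^\star_{f,l}\in\mathbb{Q}[x]$ $(0\le l\le T)$, depending only on $l$ and $f$, of degree at most $r+n-2l-1$, such that for every integer $k\ge n$ $$\sum_{(k_1,\dots,k_n)\in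 I(k,n)}f(k_1,\dots,k_n)\,t(2k_1,\dots,2k_n)=\sum_{l=0}^{\min\{T,k\}}c_{f,l}(k)\,\zeta(2l)\,t(2k-2l)$$ and $$\sum_{(k_1,\dots,k_n)\in I(k,n)}f(k_1,\dots,k_n)\,t^\star(2k_1,\dots,2k_n)=\sum_{l=0}^{\min\{T,k\}}c^\star_{f,l}(k)\,\zeta(2l)\,t(2k-2l).$$ -/

import Mathlib

noncomputable section

/-- The set of indices of weight `k` and depth `n`: all `n`-tuples of positive integers
with sum `k`. -/
def indexSet (k n : ℕ) : Finset (Fin n → ℕ) :=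
  (Finset.piAntidiag Finset.univ k).filter (fun κ => ∀ i, 0 < κ i)

/-- The multiple `t`-value: the sum of `1 / (m₁ ^ κ₁ ⋯ mₙ ^ κₙ)` over all
odd positive integers `m₁ > ⋯ > mₙ`. -/
def multipleT {n : ℕ} (κ : Fin n → ℕ) : ℝ :=
  ∑' m : {m : Fin n → ℕ // StrictAnti m ∧ ∀ i, Odd (m i)}, ∏ i, 1 / (m.1 i : ℝ) ^ κ i

/-- The multiple `t`-star value: the sum of `1 / (m₁ ^ κ₁ ⋯ mₙ ^ κₙ)` over all
odd positive integers `m₁ ≥ ⋯ ≥ mₙ`. -/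
def multipleTStar {n : ℕ} (κ : Fin n → ℕ) : ℝ :=
  ∑' m : {m : Fin n → ℕ // Antitone m ∧ ∀ i, Odd (m i)}, ∏ i, 1 / (m.1 i : ℝ) ^ κ i

/-- The single `t`-value `t(s) = ∑ 1 / m ^ s` (`m` odd, positive), with the convention
`t(0) = 0`. -/
def singleT (s : ℕ) : ℝ :=
  if s = 0 then 0 else multipleT ![s]

/-- The weighted sum `T_f(d, k, n)`, the sum over the indices `(k₁, …, kₙ)` of weight `k` of
`f(k₁, …, kₙ) t(d k₁, …, d kₙ)`. -/
def weightedT {n : ℕ} (f : MvPolynomial (Fin n) ℚ) (d k : ℕ) : ℝ :=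
  ∑ κ ∈ indexSet k n,
    ((MvPolynomial.eval (fun i => (κ i : ℚ)) f : ℚ) : ℝ) * multipleT (fun i => d * κ i)

/-- The weighted star sum `T⋆_f(d, k, n)`, the sum over the indices `(k₁, …, kₙ)` of weight `k`
of `f(k₁, …, kₙ) t⋆(d k₁, …, d kₙ)`. -/
def weightedTStar {n : ℕ} (f : MvPolynomial (Fin n) ℚ) (d k : ℕ) : ℝ :=
  ∑ κ ∈ indexSet k n,
    ((MvPolynomial.eval (fun i => (κ i : ℚ)) f : ℚ) : ℝ) * multipleTStar (fun i => d * κ i)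

end

section

open PowerSeries Submodule

/-! Put p = ∑ t(2k) X^k, Y = (π²/16) X and θ = X d/dX.

Reduction to products. A sum of a symmetric function over decreasing tuples is, up to n!, a
combination over permutations σ of its sums over σ-invariant tuples, with weight sign σ in the
strict case and 1 in the star case (`sum_strictAnti_eq`, `sum_antitone_eq`, `factorial_mul_tsum`).
An invariant tuple is a free choice of one number per cycle, so each monomial of f contributes a
product over cycles. The factor of a cycle is the coefficientwise product of (t(2k)) with a product
of series ∑ k^a X^k, that is, with a polynomial without constant term in u = ∑_{k ≥ 1} X^k.

Differential algebra. As θu = u + u², these factors are combinations of the series e_m obtained from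
p by shifted powers of θ. In closed form p = (y/4) tan(y/2) with y = π√X, hence the Riccati equation
θp = p² + p/2 + Y (`eulerOp_tSeries`). With s = p² + Y it gives e_1 = s and θs = 2ps + s, so every
e_m with m ≥ 1 is s times a polynomial in Y and p. Give Y weight 2 and p weight 1. The product over
q cycles is then α p^q plus a multiple of s of weight at most r + n (`prod_hadamard_mem`).

Return to single values. Multiples of s are combinations of Y^l e_m with m ≥ 1
(`secSpan_le_derivedSpan`), while p^q is ±Y^⌊q/2⌋ p^(q mod 2) modulo such multiples
(`tSeries_pow_sub_mem`). The coefficient of X^k in Y^l e_m is a rational polynomial in k times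
π^(2l) t(2k-2l), and π^(2l) is a rational multiple of ζ(2l). The two terms of T come from the two
kinds of summand: 2l + m + 1 ≤ r + n with m ≥ 1 gives l ≤ (r+n-2)/2, and Y^l p from an odd q ≤ n
gives l ≤ (n-1)/2. -/

/-- The Euler operator `X d/dX` on real power series. -/
noncomputable def eulerOp : Derivation ℝ ℝ⟦X⟧ ℝ⟦X⟧ := (X : ℝ⟦X⟧) • PowerSeries.derivative ℝ

lemma eulerOp_apply (f : ℝ⟦X⟧) : eulerOp f = X * PowerSeries.derivative ℝ f := rfl

lemma coeff_eulerOp (f : ℝ⟦X⟧) (k : ℕ) : coeff k (eulerOp f) = k * coeff k f := by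
  rw [eulerOp_apply]
  cases k with
  | zero => simp
  | succ k => rw [coeff_succ_X_mul, coeff_derivative]; push_cast; ring

lemma eulerOp_mul (f g : ℝ⟦X⟧) : eulerOp (f * g) = f * eulerOp g + g * eulerOp f := by
  simp [Derivation.leibniz]

lemma eulerOp_ratSmul (a : ℚ) (f : ℝ⟦X⟧) : eulerOp (a • f) = a • eulerOp f :=
  map_rat_smul eulerOp a f

/-! ### Power sums as polynomials in the geometric series. -/

/-- The power series `∑_{k ≥ 1} X ^ k`. -/
noncomputable def geomTail : ℝ⟦X⟧ := PowerSeries.mk fun k => if k = 0 then 0 else 1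

lemma coeff_geomTail (k : ℕ) : coeff k geomTail = if k = 0 then 0 else 1 := coeff_mk _ _

lemma geomTail_mul : geomTail * (1 - X) = X := by
  ext k
  rw [mul_sub, mul_one, map_sub, coeff_geomTail, coeff_X]
  rcases k with _ | _ | k <;> simp [coeff_geomTail, coeff_succ_mul_X]

lemma eulerOp_geomTail : eulerOp geomTail = geomTail + geomTail ^ 2 := by
  have h1 := congrArg eulerOp geomTail_mul
  have hX : eulerOp (X : ℝ⟦X⟧) = X := by simp [eulerOp_apply, PowerSeries.derivative_X]
  rw [eulerOp_mul, map_sub, hX, Derivation.map_one_eq_zero] at h1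
  have hne : (1 - X : ℝ⟦X⟧) ≠ 0 := by
    intro h
    have := congrArg (coeff 0) h
    simp at this
  apply mul_left_cancel₀ hne
  linear_combination h1 - geomTail_mul * (1 + geomTail)

lemma eulerOp_geomTail_pow (j : ℕ) :
    eulerOp (geomTail ^ (j + 1)) =
      ((j + 1 : ℕ) : ℚ) • (geomTail ^ (j + 1) + geomTail ^ (j + 2)) := by
  rw [Derivation.leibniz_pow, eulerOp_geomTail, Nat.cast_smul_eq_nsmul]
  simp only [smul_eq_mul, Nat.add_sub_cancel]
  ring

/-- The `ℚ`-span of `u ^ (j + 1)`, `j < d`, where `u = ∑_{k ≥ 1} X ^ k`. -/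
noncomputable def geomSpan (d : ℕ) : Submodule ℚ ℝ⟦X⟧ :=
  span ℚ {f | ∃ j, j < d ∧ f = geomTail ^ (j + 1)}

lemma geomTail_pow_mem {j d : ℕ} (h : j < d) : geomTail ^ (j + 1) ∈ geomSpan d :=
  subset_span ⟨j, h, rfl⟩

lemma geomSpan_eulerOp {d : ℕ} {f : ℝ⟦X⟧} (hf : f ∈ geomSpan d) :
    eulerOp f ∈ geomSpan (d + 1) := by
  induction hf using span_induction with
  | mem f h =>
    obtain ⟨j, hj, rfl⟩ := h
    rw [eulerOp_geomTail_pow]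
    exact smul_mem _ _ (add_mem (geomTail_pow_mem (by omega)) (geomTail_pow_mem (by omega)))
  | zero => simp
  | add f g _ _ hf hg => rw [map_add]; exact add_mem hf hg
  | smul a f _ hf => rw [eulerOp_ratSmul]; exact smul_mem _ _ hf

lemma geomSpan_mul {d e : ℕ} {f g : ℝ⟦X⟧} (hf : f ∈ geomSpan d) (hg : g ∈ geomSpan e) :
    f * g ∈ geomSpan (d + e) := by
  have h := mul_mem_mul hf hg
  rw [geomSpan, geomSpan, span_mul_span] at h
  refine span_le.2 ?_ h
  rintro _ ⟨_, ⟨i, hi, rfl⟩, _, ⟨j, hj, rfl⟩, rfl⟩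
  have := geomTail_pow_mem (show i + j + 1 < d + e by omega)
  simp only [SetLike.mem_coe]
  convert! this using 1
  ring

/-- `∑_{k ≥ 1} k ^ a X ^ k`. -/
noncomputable def powSeries (a : ℕ) : ℝ⟦X⟧ := PowerSeries.mk fun k => if k = 0 then 0 else (k : ℝ) ^ a

lemma coeff_powSeries (a k : ℕ) :
    coeff k (powSeries a) = if k = 0 then 0 else (k : ℝ) ^ a := coeff_mk _ _

/-- The Euler operator raises the exponent a by one, and by θu = u + u² it raises the degree in u by
at most one. -/
lemma powSeries_mem (a : ℕ) : powSeries a ∈ geomSpan (a + 1) := by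
  induction a with
  | zero =>
    have : powSeries 0 = geomTail ^ (0 + 1) := by ext k; simp [powSeries, geomTail]
    rw [this]; exact geomTail_pow_mem (by omega)
  | succ a ih =>
    have : powSeries (a + 1) = eulerOp (powSeries a) := by
      ext k
      rw [coeff_eulerOp, coeff_powSeries, coeff_powSeries]
      split_ifs <;> ring
    rw [this]; exact geomSpan_eulerOp ih

lemma prod_powSeries_mem {ι : Type*} (s : Finset ι) (hs : s.Nonempty) (a : ι → ℕ) :
    ∏ i ∈ s, powSeries (a i) ∈ geomSpan (∑ i ∈ s, (a i + 1)) := by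
  classical
  induction hs using Finset.Nonempty.cons_induction with
  | singleton i => simpa using powSeries_mem (a i)
  | cons i s hi hs ih =>
    rw [Finset.prod_cons, Finset.sum_cons]
    exact geomSpan_mul (powSeries_mem _) ih

/-- The coefficientwise product with a sequence. -/
noncomputable def hadamard (b : ℕ → ℝ) : ℝ⟦X⟧ →ₗ[ℚ] ℝ⟦X⟧ where
  toFun f := PowerSeries.mk fun k => coeff k f * b k
  map_add' f g := by ext k; simp [add_mul]
  map_smul' a f := by
    ext k
    simp only [coeff_mk, RingHom.id_apply]
    rw [map_rat_smul (coeff (R := ℝ) k), map_rat_smul (coeff (R := ℝ) k), coeff_mk,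
      smul_mul_assoc]

lemma coeff_hadamard (b : ℕ → ℝ) (f : ℝ⟦X⟧) (k : ℕ) :
    coeff k (hadamard b f) = coeff k f * b k :=
  coeff_mk k fun k => coeff k f * b k

lemma hadamard_eulerOp (b : ℕ → ℝ) (f : ℝ⟦X⟧) :
    hadamard b (eulerOp f) = eulerOp (hadamard b f) := by
  ext k; simp only [coeff_hadamard, coeff_eulerOp]; ring

/-! ### Riccati equations for coth, tanh and the series of t(2k). -/

section Riccati

/-- `B(x) + x / 2` where `B(x) = x / (exp x - 1)`. -/
noncomputable def bernoulliEven : ℝ⟦X⟧ := bernoulliPowerSeries ℝ + C (1 / 2 : ℝ) * X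

lemma eulerOp_X : eulerOp (X : ℝ⟦X⟧) = X := by simp [eulerOp_apply, PowerSeries.derivative_X]

lemma eulerOp_C_mul (a : ℝ) (f : ℝ⟦X⟧) : eulerOp (C a * f) = C a * eulerOp f := by
  rw [← smul_eq_C_mul, ← smul_eq_C_mul, Derivation.map_smul]

lemma C_half_add_half : (C (1 / 2 : ℝ) : ℝ⟦X⟧) + C (1 / 2 : ℝ) = 1 := by
  rw [← map_add]; norm_num

lemma exp_sub_one_ne_zero : (exp ℝ - 1 : ℝ⟦X⟧) ≠ 0 := by
  intro h
  have := congrArg (coeff 1) h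
  simp [coeff_exp, coeff_one] at this

/-- Apply θ to B (exp - 1) = X and cancel exp - 1. -/
lemma eulerOp_bernoulliPowerSeries :
    eulerOp (bernoulliPowerSeries ℝ) =
      bernoulliPowerSeries ℝ - X * bernoulliPowerSeries ℝ - bernoulliPowerSeries ℝ ^ 2 := by
  have h := bernoulliPowerSeries_mul_exp_sub_one ℝ
  have h1 := congrArg eulerOp h
  have hexp : eulerOp (exp ℝ) = X * exp ℝ := by rw [eulerOp_apply, derivative_exp]
  rw [eulerOp_mul, eulerOp_X, map_sub, hexp, Derivation.map_one_eq_zero] at h1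
  apply mul_left_cancel₀ exp_sub_one_ne_zero
  linear_combination h1 - h * (1 - X - bernoulliPowerSeries ℝ) - X * h

lemma eulerOp_bernoulliEven :
    eulerOp bernoulliEven = bernoulliEven - bernoulliEven ^ 2 + C (1 / 4 : ℝ) * X ^ 2 := by
  have h4 : (C (1 / 4 : ℝ) : ℝ⟦X⟧) = C (1 / 2 : ℝ) ^ 2 := by rw [← map_pow]; norm_num
  rw [bernoulliEven, map_add, eulerOp_C_mul, eulerOp_X, eulerOp_bernoulliPowerSeries, h4]
  linear_combination -(bernoulliPowerSeries ℝ) * X * (-C_half_add_half)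

/-- `H(2 x) - H(x)` where `H(x) = (x / 2) coth (x / 2)`; this is `(x / 2) tanh (x / 2)`. -/
noncomputable def tanhSeries : ℝ⟦X⟧ := rescale 2 bernoulliEven - bernoulliEven

/-- This is tanh · coth = 1 at x/2, multiplied by (x/2)². -/
lemma tanhSeries_mul_bernoulliEven :
    tanhSeries * bernoulliEven = C (1 / 4 : ℝ) * X ^ 2 := by
  have h := bernoulliPowerSeries_mul_exp_sub_one ℝ
  have h2 := congrArg (rescale (2 : ℝ)) h
  have hexp : rescale (2 : ℝ) (exp ℝ) = exp ℝ ^ 2 := by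
    have := exp_pow_eq_rescale_exp (A := ℝ) 2
    rw [this]; norm_num
  have hX : rescale (2 : ℝ) X = C (2 : ℝ) * X := by
    rw [rescale_X]
  have h22 : (C (2 : ℝ) : ℝ⟦X⟧) = 2 := map_ofNat C 2
  have hC : rescale (2 : ℝ) (C (1 / 2 : ℝ)) = (C (1 / 2 : ℝ) : ℝ⟦X⟧) := by
    ext k; rw [coeff_rescale, coeff_C]; split_ifs with hk <;> simp [hk]
  rw [map_mul, map_sub, map_one, hexp, hX, h22] at h2
  -- Duplication formula, from exp(2x) - 1 = (exp x - 1)(exp x + 1).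
  have h3 : rescale (2 : ℝ) (bernoulliPowerSeries ℝ) * (exp ℝ + 1) =
      2 * bernoulliPowerSeries ℝ := by
    apply mul_left_cancel₀ exp_sub_one_ne_zero
    linear_combination h2 - 2 * h
  have h4 : (C (1 / 4 : ℝ) : ℝ⟦X⟧) = C (1 / 2 : ℝ) ^ 2 := by rw [← map_pow]; norm_num
  have hne : (exp ℝ + 1 : ℝ⟦X⟧) ≠ 0 := by
    intro h
    have := congrArg (coeff 1) h
    simp [coeff_exp, coeff_one] at this
  rw [tanhSeries, bernoulliEven, map_add, map_mul, hC, hX, h22, h4]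
  have hh := C_half_add_half
  set c := (C (1 / 2 : ℝ) : ℝ⟦X⟧)
  set B := bernoulliPowerSeries ℝ
  set B2 := rescale (2 : ℝ) B
  set E := exp ℝ
  have hc : 2 * c = 1 := by linear_combination hh
  have h2c : (2 : ℝ⟦X⟧) ≠ 0 := fun h0 => by simp [h0] at hc
  apply mul_left_cancel₀ hne
  apply mul_left_cancel₀ h2c
  apply mul_left_cancel₀ h2c
  have e1 : (2 : ℝ⟦X⟧) * (2 * ((E + 1) * ((B2 + c * (2 * X) - (B + c * X)) * (B + c * X)))) =
    ((E + 1) * (2 * B2 + (2 * c) * (2 * X) - 2 * B - (2 * c) * X)) * (2 * B + (2 * c) * X) := by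
    ring
  have e2 : (2 : ℝ⟦X⟧) * (2 * ((E + 1) * (c ^ 2 * X ^ 2))) = (E + 1) * ((2 * c) ^ 2 * X ^ 2) := by
    ring
  rw [e1, e2, hc]
  linear_combination (2 * h3 - 2 * h) * (2 * B + X)  + X * (4 * h) - X * (2 * h)

lemma bernoulliEven_ne_zero : bernoulliEven ≠ 0 := by
  intro h
  have := congrArg (coeff 0) h
  simp [bernoulliEven, bernoulliPowerSeries] at this

/-- Apply θ to the relation tanh · coth = 1 and insert the Riccati equation of coth. -/
lemma eulerOp_tanhSeries :
    eulerOp tanhSeries = tanhSeries - tanhSeries ^ 2 + C (1 / 4 : ℝ) * X ^ 2 := by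
  have h := tanhSeries_mul_bernoulliEven
  have h1 := congrArg eulerOp h
  have hX2 : eulerOp (X ^ 2 : ℝ⟦X⟧) = 2 * X ^ 2 := by
    rw [pow_two, eulerOp_mul, eulerOp_X]; ring
  rw [eulerOp_mul, eulerOp_bernoulliEven, eulerOp_C_mul, hX2] at h1
  apply mul_left_cancel₀ bernoulliEven_ne_zero
  linear_combination h1 + (tanhSeries + bernoulliEven - 2) * h

lemma coeff_tanhSeries (j : ℕ) :
    coeff j tanhSeries =
      if Even j then ((2 : ℝ) ^ j - 1) * (bernoulli j : ℝ) / (j.factorial : ℝ) else 0 := by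
  rw [tanhSeries, map_sub, coeff_rescale]
  have : coeff j bernoulliEven =
      if Even j then (bernoulli j : ℝ) / (j.factorial : ℝ) else 0 := by
    rw [bernoulliEven, map_add, bernoulliPowerSeries, coeff_mk, coeff_C_mul, coeff_X]
    by_cases hj : j = 1
    · subst hj; norm_num [bernoulli_one]
    · split_ifs with he
      · simp
      · rw [bernoulli_eq_zero_of_odd (Nat.not_even_iff_odd.1 he)]
        · simp
        · rcases Nat.not_even_iff_odd.1 he with ⟨i, rfl⟩; omega
  rw [this]
  split_ifs <;> ring

lemma singleT_eq_tsum {s : ℕ} (hs : s ≠ 0) :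
    singleT s = ∑' j : ℕ, 1 / (2 * (j : ℝ) + 1) ^ s := by
  rw [singleT, if_neg hs, multipleT]
  let e : ℕ ≃ {m : Fin 1 → ℕ // StrictAnti m ∧ ∀ i, Odd (m i)} :=
    { toFun := fun j => ⟨fun _ => 2 * j + 1, Subsingleton.strictAnti _, fun _ => ⟨j, rfl⟩⟩
      invFun := fun m => (m.1 0 - 1) / 2
      left_inv := fun j => by simp
      right_inv := fun m => by
        ext i
        obtain ⟨j, hj⟩ := m.2.2 0
        rw [Subsingleton.elim i 0]
        simp only
        omega }
  rw [← e.tsum_eq]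
  simp [e]

lemma summable_odd {s : ℕ} (hs : 1 < s) :
    Summable fun j : ℕ => 1 / (2 * (j : ℝ) + 1) ^ s := by
  have h := (Real.summable_one_div_nat_pow.2 hs).comp_injective
    (i := fun j : ℕ => 2 * j + 1) (fun a b hab => by simpa using hab)
  refine h.congr fun j => ?_
  simp

/-- The coefficients `t(2k)` of the generating series are those of the hyperbolic tangent. -/
lemma singleT_even (k : ℕ) :
    singleT (2 * k) = -(1 / 2) * (-Real.pi ^ 2) ^ k * coeff (2 * k) tanhSeries := by
  rw [coeff_tanhSeries, if_pos (even_two_mul k)]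
  rcases eq_or_ne k 0 with rfl | hk
  · simp [singleT]
  have hz := hasSum_zeta_nat hk
  -- The sum over odd numbers is ζ(2k) minus its even part 2^(-2k) ζ(2k), which explains the factor
  -- 2^(2k) - 1 in the coefficients of tanh.
  have hsum := tsum_even_add_odd (f := fun n : ℕ => 1 / (n : ℝ) ^ (2 * k))
    (hz.summable.comp_injective (i := fun j : ℕ => 2 * j) fun a b hab => by simpa using hab)
    (hz.summable.comp_injective (i := fun j : ℕ => 2 * j + 1) fun a b hab => by simpa using hab)
  have he : ∑' j : ℕ, 1 / ((2 * j : ℕ) : ℝ) ^ (2 * k) =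
      1 / 2 ^ (2 * k) * ∑' j : ℕ, 1 / (j : ℝ) ^ (2 * k) := by
    rw [← tsum_mul_left]
    refine tsum_congr fun j => ?_
    push_cast
    rw [mul_pow, one_div_mul_one_div]
  rw [he, hz.tsum_eq] at hsum
  push_cast at hsum
  rw [singleT_eq_tsum (by omega), eq_sub_of_add_eq' hsum]
  obtain ⟨k, rfl⟩ := Nat.exists_eq_succ_of_ne_zero hk
  have h1 : 2 * k.succ - 1 = 2 * k + 1 := by omega
  rw [h1, neg_pow (Real.pi ^ 2), ← pow_mul]
  have h2 : (2 : ℝ) ^ (2 * k.succ) = 2 * 2 ^ (2 * k + 1) := by rw [Nat.succ_eq_add_one]; ring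
  have h3 : (-1 : ℝ) ^ (k.succ + 1) = - (-1) ^ k.succ := by ring
  rw [h2, h3]
  have : ((2 * k.succ).factorial : ℝ) ≠ 0 := by positivity
  field_simp
  ring

/-- The generating series `∑_{k ≥ 1} t(2k) X ^ k`. -/
noncomputable def tSeries : ℝ⟦X⟧ := PowerSeries.mk fun k => singleT (2 * k)

lemma coeff_tSeries (k : ℕ) : coeff k tSeries = singleT (2 * k) := coeff_mk _ _

/-- The monomial `(π² / 16) X`. -/
noncomputable def piX : ℝ⟦X⟧ := C (Real.pi ^ 2 / 16) * X

lemma coeff_two_mul_mul_of_even {f g : ℝ⟦X⟧} (hf : ∀ j, ¬ Even j → coeff j f = 0) (k : ℕ) :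
    coeff (2 * k) (f * g) =
      ∑ x ∈ Finset.HasAntidiagonal.antidiagonal k, coeff (2 * x.1) f * coeff (2 * x.2) g := by
  rw [coeff_mul]
  symm
  apply Finset.sum_of_injOn (fun x : ℕ × ℕ => (2 * x.1, 2 * x.2))
  · rintro ⟨a, b⟩ _ ⟨c, d⟩ _ h
    simp only [Prod.mk.injEq] at h ⊢
    omega
  · rintro ⟨a, b⟩ h
    simp only [Finset.mem_coe,
      Finset.HasAntidiagonal.mem_antidiagonal] at h ⊢
    omega
  · rintro ⟨a, b⟩ h hn
    rw [hf a, zero_mul]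
    rintro ⟨c, hc⟩
    apply hn
    rw [Finset.HasAntidiagonal.mem_antidiagonal] at h
    exact ⟨(c, k - c), by simp only [Finset.mem_coe,
      Finset.HasAntidiagonal.mem_antidiagonal] at *; omega, by simp only [Prod.mk.injEq]; dsimp only at *; omega⟩
  · intros; rfl

/-- The Riccati equation of the generating series of `t(2k)`. -/
lemma eulerOp_tSeries :
    eulerOp tSeries = tSeries ^ 2 + (1 / 2 : ℚ) • tSeries + piX := by
  ext k
  -- The variables are related by x² = -π² X, so x d/dx is twice X d/dX; the coefficient of X^k is
  -- read off from that of x^(2k).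
  have h := congrArg (coeff (2 * k)) eulerOp_tanhSeries
  have hodd : ∀ j, ¬ Even j → coeff j tanhSeries = 0 := fun j hj => by
    rw [coeff_tanhSeries, if_neg hj]
  rw [coeff_eulerOp, map_add, map_sub, pow_two, coeff_two_mul_mul_of_even hodd, coeff_C_mul,
    coeff_X_pow] at h
  have hq : coeff k ((1 / 2 : ℚ) • tSeries) = 1 / 2 * singleT (2 * k) := by
    rw [map_rat_smul (coeff (R := ℝ) k), coeff_tSeries, Rat.smul_def]; norm_num
  have hsq : coeff k (tSeries ^ 2) = 1 / 4 * (-Real.pi ^ 2) ^ k *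
      ∑ x ∈ Finset.HasAntidiagonal.antidiagonal k, coeff (2 * x.1) tanhSeries * coeff (2 * x.2) tanhSeries := by
    rw [pow_two, coeff_mul, Finset.mul_sum]
    refine Finset.sum_congr rfl fun x hx => ?_
    rw [← Finset.HasAntidiagonal.mem_antidiagonal.1 hx, coeff_tSeries, coeff_tSeries, singleT_even, singleT_even,
      pow_add]
    ring
  rw [coeff_eulerOp, map_add, map_add, hq, hsq, coeff_tSeries, piX, coeff_C_mul, coeff_X,
    singleT_even]
  push_cast at h
  by_cases hk : k = 1
  · subst hk
    simp only [if_true, mul_one] at h ⊢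
    linear_combination -(1 / 4) * (-Real.pi ^ 2) * h
  · rw [if_neg (by omega)] at h
    rw [if_neg hk]
    linear_combination -(1 / 4) * (-Real.pi ^ 2) ^ k * h

end Riccati

/-! ### The filtered algebra generated by Y and p, and its multiples of s = p² + Y. -/

section Span

lemma eulerOp_piX : eulerOp piX = piX := by rw [piX, eulerOp_C_mul, eulerOp_X]

lemma eulerOp_piX_pow (l : ℕ) : eulerOp (piX ^ l) = (l : ℚ) • piX ^ l := by
  rw [Derivation.leibniz_pow, eulerOp_piX, Nat.cast_smul_eq_nsmul]
  rcases l with _ | l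
  · simp
  · simp only [smul_eq_mul, Nat.add_sub_cancel]; rw [pow_succ]

/-- The derived series `e_m`: `e_0 = ∑ t(2k) X ^ k` and `e_{m+1} = (θ - (m + 1) / 2) e_m`. -/
noncomputable def eulerSeq : ℕ → ℝ⟦X⟧
  | 0 => tSeries
  | m + 1 => eulerOp (eulerSeq m) - (((m : ℚ) + 1) / 2) • eulerSeq m

/-- `p ^ 2 + Y`, where `p` is the generating series and `Y = (π² / 16) X`. -/
noncomputable def secSeries : ℝ⟦X⟧ := tSeries ^ 2 + piX

lemma eulerOp_tSeries' : eulerOp tSeries = secSeries + (1 / 2 : ℚ) • tSeries := by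
  rw [eulerOp_tSeries, secSeries]; ring

/-- By this identity multiples of s are stable under θ. -/
lemma eulerOp_secSeries : eulerOp secSeries = 2 * tSeries * secSeries + secSeries := by
  have h : (1 / 2 : ℚ) • tSeries + (1 / 2 : ℚ) • tSeries = tSeries := by
    rw [← add_smul]; norm_num
  rw [secSeries, map_add, pow_two, eulerOp_mul, eulerOp_piX, eulerOp_tSeries]
  linear_combination tSeries * h

/-- The `ℚ`-span of the `Y ^ l p ^ b` with `2 l + b ≤ d`. -/
noncomputable def weightSpan (d : ℕ) : Submodule ℚ ℝ⟦X⟧ :=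
  span ℚ {f | ∃ l b, 2 * l + b ≤ d ∧ f = piX ^ l * tSeries ^ b}

/-- The `ℚ`-span of the `(p ^ 2 + Y) Y ^ l p ^ b` with `2 l + b + 2 ≤ d`. -/
noncomputable def secSpan (d : ℕ) : Submodule ℚ ℝ⟦X⟧ :=
  span ℚ {f | ∃ l b, 2 * l + b + 2 ≤ d ∧ f = piX ^ l * tSeries ^ b * secSeries}

/-- The `ℚ`-span of the `Y ^ l e_m` with `m ≥ 1` and `2 l + m + 1 ≤ d`. -/
noncomputable def derivedSpan (d : ℕ) : Submodule ℚ ℝ⟦X⟧ :=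
  span ℚ {f | ∃ l m, 1 ≤ m ∧ 2 * l + m + 1 ≤ d ∧ f = piX ^ l * eulerSeq m}

lemma mem_weightSpan {l b d : ℕ} (h : 2 * l + b ≤ d) :
    piX ^ l * tSeries ^ b ∈ weightSpan d := subset_span ⟨l, b, h, rfl⟩

lemma mem_secSpan {l b d : ℕ} (h : 2 * l + b + 2 ≤ d) :
    piX ^ l * tSeries ^ b * secSeries ∈ secSpan d := subset_span ⟨l, b, h, rfl⟩

lemma mem_derivedSpan {l m d : ℕ} (hm : 1 ≤ m) (h : 2 * l + m + 1 ≤ d) :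
    piX ^ l * eulerSeq m ∈ derivedSpan d := subset_span ⟨l, m, hm, h, rfl⟩

lemma secSpan_mono {d e : ℕ} (h : d ≤ e) : secSpan d ≤ secSpan e := by
  refine span_mono ?_
  rintro f ⟨l, b, hlb, rfl⟩
  exact ⟨l, b, by omega, rfl⟩

lemma derivedSpan_mono {d e : ℕ} (h : d ≤ e) : derivedSpan d ≤ derivedSpan e := by
  refine span_mono ?_
  rintro f ⟨l, m, hm, hlb, rfl⟩
  exact ⟨l, m, hm, by omega, rfl⟩

lemma weightSpan_mul_secSpan {d e : ℕ} {f g : ℝ⟦X⟧} (hf : f ∈ weightSpan d)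
    (hg : g ∈ secSpan e) : f * g ∈ secSpan (d + e) := by
  have h := mul_mem_mul hf hg
  rw [weightSpan, secSpan, span_mul_span] at h
  refine span_le.2 ?_ h
  rintro _ ⟨_, ⟨i, b, hi, rfl⟩, _, ⟨j, c, hj, rfl⟩, rfl⟩
  have := mem_secSpan (show 2 * (i + j) + (b + c) + 2 ≤ d + e by omega)
  simp only [SetLike.mem_coe]
  convert! this using 1
  ring

lemma secSpan_le_weightSpan (d : ℕ) : secSpan d ≤ weightSpan d := by
  refine span_le.2 ?_
  rintro f ⟨l, b, h, rfl⟩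
  rw [secSeries]
  have h1 := mem_weightSpan (show 2 * l + (b + 2) ≤ d by omega)
  have h2 := mem_weightSpan (show 2 * (l + 1) + b ≤ d by omega)
  have := add_mem h1 h2
  rw [SetLike.mem_coe]
  convert! this using 1
  ring

lemma eulerOp_monomial (l b : ℕ) :
    eulerOp (piX ^ l * tSeries ^ b) =
      ((l : ℚ) + b / 2) • (piX ^ l * tSeries ^ b) +
        (b : ℚ) • (piX ^ l * tSeries ^ (b - 1) * secSeries) := by
  rw [eulerOp_mul, eulerOp_piX_pow, Derivation.leibniz_pow, eulerOp_tSeries']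
  rcases b with _ | b
  · simp
  · simp only [smul_eq_mul, Nat.add_sub_cancel, ← Nat.cast_smul_eq_nsmul ℚ, mul_add,
      mul_smul_comm, smul_add, smul_smul, add_smul, pow_succ]
    rw [show tSeries ^ b * tSeries * piX ^ l = piX ^ l * (tSeries ^ b * tSeries) by ring,
      ← mul_assoc (piX ^ l) _ secSeries, mul_div_assoc', mul_one]
    abel

lemma secSpan_eulerOp {d : ℕ} {f : ℝ⟦X⟧} (hf : f ∈ secSpan d) : eulerOp f ∈ secSpan (d + 1) := by
  induction hf using span_induction with
  | mem f h =>
    obtain ⟨l, b, h, rfl⟩ := h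
    have hw : piX ^ l * tSeries ^ b ∈ weightSpan (d - 2) := mem_weightSpan (by omega)
    have hs : secSeries ∈ secSpan 2 := by
      simpa using mem_secSpan (l := 0) (b := 0) (d := 2) (by omega)
    rw [eulerOp_mul, eulerOp_secSeries, eulerOp_monomial]
    have e : piX ^ l * tSeries ^ b * (2 * tSeries * secSeries + secSeries) +
        secSeries * (((l : ℚ) + b / 2) • (piX ^ l * tSeries ^ b) +
          (b : ℚ) • (piX ^ l * tSeries ^ (b - 1) * secSeries)) =
        (2 : ℚ) • (piX ^ l * tSeries ^ (b + 1) * secSeries) +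
          ((1 : ℚ) + (l + b / 2)) • (piX ^ l * tSeries ^ b * secSeries) +
          (b : ℚ) • (piX ^ l * tSeries ^ (b - 1) * secSeries * secSeries) := by
      simp only [Algebra.smul_def, map_add, map_one, map_natCast, map_ofNat, div_eq_mul_inv, map_mul]
      ring
    rw [e]
    refine add_mem (add_mem (smul_mem _ _ (mem_secSpan (by omega)))
      (smul_mem _ _ (mem_secSpan (by omega)))) ?_
    rcases b with _ | b
    · simp
    · refine smul_mem _ _ ?_
      rw [Nat.add_sub_cancel]
      have h1 : piX ^ l * tSeries ^ b * secSeries ∈ weightSpan (d - 1) :=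
        secSpan_le_weightSpan _ (mem_secSpan (by omega))
      exact secSpan_mono (by omega) (weightSpan_mul_secSpan h1 hs)
  | zero => simp
  | add f g _ _ hf hg => rw [map_add]; exact add_mem hf hg
  | smul a f _ hf => rw [eulerOp_ratSmul]; exact smul_mem _ _ hf

/-- The first shift 1/2 cancels the term p/2 of the Riccati equation, so e_1 = s; afterwards θ keeps
multiples of s and raises the weight by at most one. -/
lemma eulerSeq_mem_secSpan (m : ℕ) : eulerSeq (m + 1) ∈ secSpan (m + 2) := by
  induction m with
  | zero =>
    have : eulerSeq 1 = piX ^ 0 * tSeries ^ 0 * secSeries := by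
      rw [eulerSeq, eulerSeq, eulerOp_tSeries']; simp
    rw [this]
    exact mem_secSpan (by omega)
  | succ m ih =>
    rw [eulerSeq]
    exact sub_mem (secSpan_eulerOp ih) (smul_mem _ _ (secSpan_mono (by omega) ih))

lemma eulerOp_piX_pow_mul_eulerSeq (l m : ℕ) :
    eulerOp (piX ^ l * eulerSeq m) =
      piX ^ l * eulerSeq (m + 1) +
        ((l : ℚ) + (m + 1) / 2) • (piX ^ l * eulerSeq m) := by
  have : eulerOp (eulerSeq m) = eulerSeq (m + 1) +
      (((m : ℚ) + 1) / 2) • eulerSeq m := by rw [eulerSeq]; ring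
  rw [eulerOp_mul, eulerOp_piX_pow, this, mul_add, mul_smul_comm, mul_smul_comm, add_smul,
    mul_comm (eulerSeq m)]
  ring

lemma derivedSpan_eulerOp {d : ℕ} {f : ℝ⟦X⟧} (hf : f ∈ derivedSpan d) :
    eulerOp f ∈ derivedSpan (d + 1) := by
  induction hf using span_induction with
  | mem f h =>
    obtain ⟨l, m, hm, h, rfl⟩ := h
    rw [eulerOp_piX_pow_mul_eulerSeq]
    exact add_mem (mem_derivedSpan (by omega) (by omega))
      (smul_mem _ _ (mem_derivedSpan hm (by omega)))
  | zero => simp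
  | add f g _ _ hf hg => rw [map_add]; exact add_mem hf hg
  | smul a f _ hf => rw [eulerOp_ratSmul]; exact smul_mem _ _ hf

lemma piX_pow_mul_derivedSpan {d : ℕ} (i : ℕ) {f : ℝ⟦X⟧} (hf : f ∈ derivedSpan d) :
    piX ^ i * f ∈ derivedSpan (d + 2 * i) := by
  induction hf using span_induction with
  | mem f h =>
    obtain ⟨l, m, hm, h, rfl⟩ := h
    rw [← mul_assoc, ← pow_add]
    exact mem_derivedSpan hm (by omega)
  | zero => simp
  | add f g _ _ hf hg => rw [mul_add]; exact add_mem hf hg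
  | smul a f _ hf => rw [mul_smul_comm]; exact smul_mem _ _ hf

/-- Since θ(p^b s) = (b+2) p^(b+1) s + (b/2+1) p^b s + b Y p^(b-1) s, one can solve for p^(b+1) s
and induct on b. -/
lemma tSeries_pow_mul_secSeries_mem (b : ℕ) :
    tSeries ^ b * secSeries ∈ derivedSpan (b + 2) := by
  induction b using Nat.strong_induction_on with
  | _ b ih =>
    rcases b with _ | b
    · have : eulerSeq 1 = secSeries := by
        rw [eulerSeq, eulerSeq, eulerOp_tSeries']; simp
      have h := mem_derivedSpan (l := 0) (m := 1) (d := 2) le_rfl (by omega)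
      simpa [this] using h
    · have hb := ih b (by omega)
      have h1 := derivedSpan_eulerOp hb
      have e1 := eulerOp_monomial 0 b
      simp only [pow_zero, one_mul, Nat.cast_zero, zero_add] at e1
      rw [eulerOp_mul, eulerOp_secSeries, e1] at h1
      have key : (((b : ℚ) + 2)⁻¹) • ((tSeries ^ b * (2 * tSeries * secSeries + secSeries) +
          secSeries * (((b : ℚ) / 2) • tSeries ^ b +
            (b : ℚ) • (tSeries ^ (b - 1) * secSeries))) -
          ((b : ℚ) / 2 + 1) • (tSeries ^ b * secSeries) -
          (b : ℚ) • (piX * (tSeries ^ (b - 1) * secSeries))) = tSeries ^ (b + 1) * secSeries := by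
        have hne : (b : ℚ) + 2 ≠ 0 := by positivity
        rw [inv_smul_eq_iff₀ hne]
        have hs : (b : ℝ⟦X⟧) * (tSeries ^ (b - 1) * secSeries * secSeries) =
            b * (tSeries ^ (b + 1) * secSeries + piX * (tSeries ^ (b - 1) * secSeries)) := by
          rcases b with _ | b
          · simp
          · rw [Nat.add_sub_cancel]
            nth_rw 2 [secSeries]
            ring
        simp only [Algebra.smul_def, map_add, map_one, map_natCast, map_ofNat, div_eq_mul_inv,
          map_mul]
        linear_combination hs
      rw [← key]
      refine smul_mem _ _ (sub_mem (sub_mem h1 (smul_mem _ _ (derivedSpan_mono (by omega) hb))) ?_)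
      rcases b with _ | b
      · simp
      · have := piX_pow_mul_derivedSpan 1 (ih b (by omega))
        rw [pow_one] at this
        exact smul_mem _ _ (derivedSpan_mono (by omega) this)

lemma secSpan_le_derivedSpan (d : ℕ) : secSpan d ≤ derivedSpan d := by
  refine span_le.2 ?_
  rintro f ⟨l, b, h, rfl⟩
  rw [mul_assoc]
  exact derivedSpan_mono (by omega) (piX_pow_mul_derivedSpan l (tSeries_pow_mul_secSeries_mem b))

/-- Modulo s one has p² = -Y. -/
lemma tSeries_pow_sub_mem (q : ℕ) :
    tSeries ^ q - (-1 : ℚ) ^ (q / 2) • (piX ^ (q / 2) * tSeries ^ (q % 2)) ∈ secSpan q := by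
  induction q using Nat.twoStepInduction with
  | zero => simp
  | one => simp
  | more q ih _ =>
    have h1 := weightSpan_mul_secSpan (mem_weightSpan (l := 1) (b := 0) (d := 2) (by omega)) ih
    have h2 := mem_secSpan (l := 0) (b := q) (d := q + 2) (by omega)
    have h3 := sub_mem h2 (secSpan_mono (by omega) h1)
    have e1 : (q + 2) / 2 = q / 2 + 1 := by omega
    have e2 : (q + 2) % 2 = q % 2 := by omega
    rw [e1, e2, pow_succ (-1 : ℚ), mul_neg_one, neg_smul]
    convert! h3 using 1
    rw [pow_zero, one_mul, pow_one, pow_zero, mul_one, mul_sub, secSeries]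
    simp only [Algebra.smul_def]
    ring

/-- Hadamard products of powers of `u` with the sequence `t(2k)`. -/
lemma hadamard_geomTail_pow (j : ℕ) :
    ∃ α : ℚ, ∃ h ∈ secSpan (j + 1),
      hadamard (fun k => singleT (2 * k)) (geomTail ^ (j + 1)) = α • tSeries + h := by
  set Φ := hadamard (fun k => singleT (2 * k)) with hΦ
  -- It is enough to reach the span of e_0, …, e_j: e_0 = p supplies α, and every later e_m is a
  -- multiple of s.
  suffices H : Φ (geomTail ^ (j + 1)) ∈ span ℚ {f | ∃ m ≤ j, f = eulerSeq m} by
    generalize Φ (geomTail ^ (j + 1)) = F at H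
    induction H using span_induction with
    | mem f h =>
      obtain ⟨m, hm, rfl⟩ := h
      rcases m with _ | m
      · exact ⟨1, 0, zero_mem _, by simp [eulerSeq]⟩
      · exact ⟨0, _, secSpan_mono (by omega) (eulerSeq_mem_secSpan m), by simp⟩
    | zero => exact ⟨0, 0, zero_mem _, by simp⟩
    | add f g _ _ hf hg =>
      obtain ⟨α, h, hh, rfl⟩ := hf
      obtain ⟨β, h', hh', rfl⟩ := hg
      exact ⟨α + β, h + h', add_mem hh hh', by rw [add_smul]; ring⟩
    | smul a f _ hf =>
      obtain ⟨α, h, hh, rfl⟩ := hf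
      exact ⟨a * α, a • h, smul_mem _ _ hh, by rw [smul_add, smul_smul]⟩
  induction j with
  | zero =>
    refine subset_span ⟨0, le_rfl, ?_⟩
    ext k
    rw [hΦ, coeff_hadamard, eulerSeq, coeff_tSeries, zero_add, pow_one, coeff_geomTail]
    split_ifs with hk <;> simp [hk, singleT]
  | succ j ih =>
    have h1 := congrArg Φ (eulerOp_geomTail_pow j)
    rw [hadamard_eulerOp, map_smul, map_add, ← hΦ] at h1
    have hne : ((j + 1 : ℕ) : ℚ) ≠ 0 := by positivity
    -- The coefficientwise product commutes with θ, so θu^(j+1) = (j+1)(u^(j+1) + u^(j+2)) becomes a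
    -- recursion.
    have h2 : Φ (geomTail ^ (j + 1 + 1)) = ((j + 1 : ℕ) : ℚ)⁻¹ • eulerOp (Φ (geomTail ^ (j + 1))) -
        Φ (geomTail ^ (j + 1)) := by
      rw [h1, inv_smul_smul₀ hne]; ring
    rw [h2]
    refine sub_mem (smul_mem _ _ ?_) (span_mono ?_ ih)
    · clear h1 h2
      generalize Φ (geomTail ^ (j + 1)) = F at ih
      induction ih using span_induction with
      | mem f h =>
        obtain ⟨m, hm, rfl⟩ := h
        have := eulerOp_piX_pow_mul_eulerSeq 0 m
        rw [pow_zero, one_mul, one_mul] at this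
        rw [this]
        exact add_mem (subset_span ⟨m + 1, by omega, rfl⟩)
          (smul_mem _ _ (subset_span ⟨m, by omega, rfl⟩))
      | zero => simp
      | add f g _ _ hf hg => rw [map_add]; exact add_mem hf hg
      | smul a f _ hf => rw [eulerOp_ratSmul]; exact smul_mem _ _ hf
    · rintro f ⟨m, hm, rfl⟩
      exact ⟨m, by omega, rfl⟩

lemma hadamard_of_mem_geomSpan {d : ℕ} {f : ℝ⟦X⟧} (hf : f ∈ geomSpan d) :
    ∃ α : ℚ, ∃ h ∈ secSpan d,
      hadamard (fun k => singleT (2 * k)) f = α • tSeries + h := by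
  induction hf using span_induction with
  | mem f h =>
    obtain ⟨j, hj, rfl⟩ := h
    obtain ⟨α, h, hh, e⟩ := hadamard_geomTail_pow j
    exact ⟨α, h, secSpan_mono (by omega) hh, e⟩
  | zero => exact ⟨0, 0, zero_mem _, by simp⟩
  | add f g _ _ hf hg =>
    obtain ⟨α, h, hh, e⟩ := hf
    obtain ⟨β, h', hh', e'⟩ := hg
    exact ⟨α + β, h + h', add_mem hh hh', by rw [map_add, e, e', add_smul]; ring⟩
  | smul a f _ hf =>
    obtain ⟨α, h, hh, e⟩ := hf
    exact ⟨a * α, a • h, smul_mem _ _ hh, by rw [map_smul, e, smul_add, smul_smul]⟩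

/-- When the factors α_i p + h_i are multiplied out, every term but the pure power of p contains
some h_i and is thus a multiple of s; weights add. -/
lemma prod_hadamard_mem {ι : Type*} (s : Finset ι) (d : ι → ℕ) (hd : ∀ i ∈ s, 1 ≤ d i)
    (f : ι → ℝ⟦X⟧) (hf : ∀ i ∈ s, f i ∈ geomSpan (d i)) :
    ∃ α : ℚ, ∃ h ∈ secSpan (∑ i ∈ s, d i),
      ∏ i ∈ s, hadamard (fun k => singleT (2 * k)) (f i) = α • tSeries ^ s.card + h := by
  classical
  induction s using Finset.cons_induction with
  | empty => exact ⟨1, 0, zero_mem _, by simp⟩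
  | cons i s hi ih =>
    obtain ⟨α, h, hh, e⟩ := ih (fun j hj => hd j (Finset.mem_cons_of_mem hj))
      (fun j hj => hf j (Finset.mem_cons_of_mem hj))
    obtain ⟨β, g, hg, e'⟩ := hadamard_of_mem_geomSpan (hf i (Finset.mem_cons_self i s))
    have hdi := hd i (Finset.mem_cons_self i s)
    have hcard : s.card ≤ ∑ i ∈ s, d i := by
      rw [Finset.card_eq_sum_ones]
      exact Finset.sum_le_sum fun j hj => hd j (Finset.mem_cons_of_mem hj)
    rw [Finset.prod_cons, Finset.sum_cons, Finset.card_cons, e, e']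
    have hp := mem_weightSpan (l := 0) (b := 1) (d := d i) (by omega)
    have hq := mem_weightSpan (l := 0) (b := s.card) (d := ∑ i ∈ s, d i) (by omega)
    simp only [pow_zero, one_mul, pow_one] at hp hq
    refine ⟨β * α, β • (tSeries * h) + α • (tSeries ^ s.card * g) + g * h,
      add_mem (add_mem (smul_mem _ _ (weightSpan_mul_secSpan hp hh)) (smul_mem _ _ ?_))
        (weightSpan_mul_secSpan (secSpan_le_weightSpan _ hg) hh), ?_⟩
    · rw [add_comm (d i)]; exact weightSpan_mul_secSpan hq hg
    · rw [add_mul, mul_add, mul_add, smul_mul_smul_comm, smul_mul_assoc, mul_smul_comm, pow_succ,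
        mul_comm g (tSeries ^ _), mul_comm tSeries (tSeries ^ _)]
      ring

end Span

/-! ### From ordered tuples to tuples fixed by a permutation. -/

section Symmetrization

open scoped Classical

lemma tsum_subtype_eq_tsum_ite {α : Type*} (P : α → Prop) [DecidablePred P]
    (F : α → ℝ) :
    ∑' m : {m // P m}, F m = ∑' m, if P m then F m else 0 := by
  have h := Subtype.val_injective (p := P)
  rw [← h.tsum_eq (f := fun m => if P m then F m else 0)]
  · exact tsum_congr fun m => by rw [if_pos m.2]
  · intro m hm
    by_cases hP : P m
    · exact ⟨⟨m, hP⟩, rfl⟩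
    · simp [hP] at hm

lemma tsum_comp_perm {n : ℕ} (F : (Fin n → ℕ) → ℝ) (σ : Equiv.Perm (Fin n)) :
    ∑' m : Fin n → ℕ, F (m ∘ σ) = ∑' m, F m :=
  (Equiv.arrowCongr σ.symm (Equiv.refl ℕ)).tsum_eq F

lemma exists_antitone_comp {n : ℕ} (m : Fin n → ℕ) :
    ∃ σ : Equiv.Perm (Fin n), Antitone (m ∘ σ) := by
  refine ⟨Fin.revPerm.trans (Tuple.sort m), fun i j hij => ?_⟩
  exact Tuple.monotone_sort m (Fin.rev_le_rev.2 hij)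

/-- The decreasing rearrangement is unique, so the permutations that sort m form a coset of its
stabilizer. -/
lemma sum_antitone_eq {n : ℕ} (m : Fin n → ℕ) :
    ∑ σ : Equiv.Perm (Fin n), (if Antitone (m ∘ σ) then (1 : ℝ) else 0) =
      ∑ σ : Equiv.Perm (Fin n), if m ∘ σ = m then (1 : ℝ) else 0 := by
  obtain ⟨τ, hτ⟩ := exists_antitone_comp m
  rw [← Equiv.sum_comp (Equiv.mulRight τ⁻¹) fun σ : Equiv.Perm (Fin n) =>
    if m ∘ σ = m then (1 : ℝ) else 0]
  refine Finset.sum_congr rfl fun σ _ => ?_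
  have : Antitone (m ∘ σ) ↔ m ∘ (Equiv.mulRight τ⁻¹ σ) = m := by
    constructor
    · intro h
      have := Tuple.unique_antitone h hτ
      ext i
      have h2 := congrFun this (τ⁻¹ i)
      simpa using h2
    · intro h
      have : m ∘ σ = m ∘ τ := by
        ext i
        have h2 := congrFun h (τ i)
        simpa using h2
      rw [this]; exact hτ
  simp only [this]

lemma strictAnti_iff_antitone_and_injective {n : ℕ} (m : Fin n → ℕ) (σ : Equiv.Perm (Fin n)) :
    StrictAnti (m ∘ σ) ↔ Antitone (m ∘ σ) ∧ Function.Injective m := by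
  constructor
  · intro h
    refine ⟨h.antitone, ?_⟩
    have := h.injective
    rwa [Function.Injective.of_comp_iff' _ σ.bijective] at this
  · rintro ⟨h, hi⟩
    exact h.strictAnti_of_injective (hi.comp σ.injective)

/-- If m is injective, its stabilizer is trivial and the count is 1. Otherwise nothing sorts m
strictly, and a transposition in the stabilizer makes the signs cancel. -/
lemma sum_strictAnti_eq {n : ℕ} (m : Fin n → ℕ) :
    ∑ σ : Equiv.Perm (Fin n), (if StrictAnti (m ∘ σ) then (1 : ℝ) else 0) =
      ∑ σ : Equiv.Perm (Fin n), if m ∘ σ = m then ((Equiv.Perm.sign σ : ℤ) : ℝ) else 0 := by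
  simp only [strictAnti_iff_antitone_and_injective]
  by_cases hm : Function.Injective m
  · simp only [hm, and_true]
    rw [sum_antitone_eq]
    refine Finset.sum_congr rfl fun σ _ => ?_
    split_ifs with h
    · have : σ = 1 := by
        ext i
        rw [hm (congrFun h i)]
        rfl
      simp [this]
    · rfl
  · simp only [hm, and_false, if_false, Finset.sum_const_zero]
    rw [Function.Injective] at hm
    push Not at hm
    obtain ⟨i, j, hij, hne⟩ := hm
    have hs : ∀ x, m (Equiv.swap i j x) = m x := by
      intro x
      rcases eq_or_ne x i with rfl | hi
      · simp [hij]
      rcases eq_or_ne x j with rfl | hj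
      · simp [hij]
      · rw [Equiv.swap_apply_of_ne_of_ne hi hj]
    have key := Equiv.sum_comp (Equiv.mulLeft (Equiv.swap i j)) fun σ : Equiv.Perm (Fin n) =>
      if m ∘ σ = m then ((Equiv.Perm.sign σ : ℤ) : ℝ) else 0
    have h2 : ∀ σ : Equiv.Perm (Fin n), m ∘ (Equiv.mulLeft (Equiv.swap i j) σ) = m ∘ σ :=
      fun σ => funext fun x => hs (σ x)
    simp only [h2] at key
    simp only [Equiv.coe_mulLeft, Equiv.Perm.sign_mul, Equiv.Perm.sign_swap hne] at key
    simp only [neg_mul, one_mul, Units.val_neg, Int.cast_neg] at key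
    have h3 : ∀ σ : Equiv.Perm (Fin n),
        (if m ∘ σ = m then -((Equiv.Perm.sign σ : ℤ) : ℝ) else 0) =
          -(if m ∘ σ = m then ((Equiv.Perm.sign σ : ℤ) : ℝ) else 0) := fun σ => by
      split_ifs <;> simp
    simp only [h3, Finset.sum_neg_distrib] at key
    linarith

lemma summable_ite {α : Type*} {F : α → ℝ} (hF : Summable F) (P : α → Prop)
    [DecidablePred P] (c : ℝ) :
    Summable fun m => (if P m then c else 0) * F m := by
  refine Summable.of_norm_bounded (g := fun m => |c| * |F m|) (hF.abs.mul_left _) fun m => ?_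
  rw [Real.norm_eq_abs, abs_mul]
  split_ifs
  · rfl
  · simpa using by positivity

lemma factorial_mul_tsum {n : ℕ} {G : (Fin n → ℕ) → ℝ} (hG : Summable G)
    (hsymm : ∀ (σ : Equiv.Perm (Fin n)) m, G (m ∘ σ) = G m)
    (P : (Fin n → ℕ) → Prop) [DecidablePred P] (χ : Equiv.Perm (Fin n) → ℝ)
    (hP : ∀ m, ∑ σ : Equiv.Perm (Fin n), (if P (m ∘ σ) then (1 : ℝ) else 0) =
      ∑ σ : Equiv.Perm (Fin n), if m ∘ σ = m then χ σ else 0) :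
    (n.factorial : ℝ) * ∑' m, (if P m then G m else 0) =
      ∑ σ : Equiv.Perm (Fin n), χ σ * ∑' m : Fin n → ℕ, (if m ∘ σ = m then G m else 0) := by
  have h1 : (n.factorial : ℝ) * ∑' m, (if P m then G m else 0) =
      ∑ σ : Equiv.Perm (Fin n), ∑' m : Fin n → ℕ, (if P (m ∘ σ) then (1 : ℝ) else 0) * G m := by
    have : ∀ σ : Equiv.Perm (Fin n),
        ∑' m : Fin n → ℕ, (if P (m ∘ σ) then (1 : ℝ) else 0) * G m =
          ∑' m, (if P m then G m else 0) := fun σ => by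
      rw [← tsum_comp_perm (fun m => if P m then G m else 0) σ]
      refine tsum_congr fun m => ?_
      rw [hsymm]
      split_ifs <;> simp
    simp only [this, Finset.sum_const, nsmul_eq_mul, Finset.card_univ, Fintype.card_perm,
      Fintype.card_fin]
  rw [h1, ← Summable.tsum_finsetSum fun σ _ => summable_ite hG _ _]
  simp only [← Finset.sum_mul, hP]
  simp only [Finset.sum_mul]
  rw [Summable.tsum_finsetSum fun (σ : Equiv.Perm (Fin n)) _ =>
    summable_ite hG (fun m : Fin n → ℕ => m ∘ σ = m) (χ σ)]
  refine Finset.sum_congr rfl fun σ _ => ?_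
  rw [← tsum_mul_left]
  refine tsum_congr fun m => ?_
  split_ifs <;> simp

/-- C is the set of cycles of σ, fixed points included: a tuple is invariant exactly when it is
constant on cycles. -/
lemma exists_cycle_quotient {n : ℕ} (σ : Equiv.Perm (Fin n)) :
    ∃ (C : Type) (_ : Fintype C) (π : Fin n → C), Function.Surjective π ∧
      ∀ m : Fin n → ℕ, m ∘ σ = m ↔ ∃ m' : C → ℕ, m = m' ∘ π := by
  let S := Equiv.Perm.SameCycle.setoid σ
  refine ⟨Quotient S, inferInstance, Quotient.mk S, Quotient.mk_surjective, fun m => ?_⟩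
  constructor
  · intro h
    have h1 : ∀ i, m (σ i) = m i := fun i => congrFun h i
    have hp : ∀ (k : ℕ) i, m ((σ ^ k) i) = m i := by
      intro k
      induction k with
      | zero => simp
      | succ k ih => intro i; rw [pow_succ', Equiv.Perm.mul_apply, h1, ih]
    refine ⟨Quotient.lift m ?_, rfl⟩
    rintro i j hij
    obtain ⟨k, rfl⟩ := (show σ.SameCycle i j from hij).exists_nat_pow_eq
    rw [hp]
  · rintro ⟨m', rfl⟩
    ext i
    have : (Quotient.mk S (σ i)) = Quotient.mk S i :=
      Quotient.sound (s := S) (show σ.SameCycle (σ i) i from Equiv.Perm.sameCycle_apply_left.2 (Equiv.Perm.SameCycle.refl σ i))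
    simp [this]

lemma tsum_fixed_eq {n : ℕ} {σ : Equiv.Perm (Fin n)} {C : Type} {π : Fin n → C}
    (hπ : Function.Surjective π)
    (h : ∀ m : Fin n → ℕ, m ∘ σ = m ↔ ∃ m' : C → ℕ, m = m' ∘ π) (F : (Fin n → ℕ) → ℝ) :
    ∑' m : Fin n → ℕ, (if m ∘ σ = m then F m else 0) = ∑' m' : C → ℕ, F (m' ∘ π) := by
  have hinj : Function.Injective fun m' : C → ℕ => m' ∘ π := hπ.injective_comp_right
  rw [← hinj.tsum_eq]
  · exact tsum_congr fun m' => if_pos ((h _).2 ⟨m', rfl⟩)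
  · intro m hm
    by_cases hc : m ∘ σ = m
    · obtain ⟨m', rfl⟩ := (h m).1 hc
      exact ⟨m', rfl⟩
    · simp [hc] at hm

end Symmetrization

/-! ### Sums over free tuples as products of series. -/

section Products

lemma hasSum_fin_prod {n : ℕ} (g : Fin n → ℕ → ℝ) (a : Fin n → ℝ)
    (h : ∀ i, HasSum (g i) (a i)) :
    HasSum (fun m : Fin n → ℕ => ∏ i, g i (m i)) (∏ i, a i) := by
  induction n with
  | zero => simp
  | succ n ih =>
    have h1 := ih (fun i => g i.succ) (fun i => a i.succ) fun i => h i.succ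
    have hs : Summable fun x : ℕ × (Fin n → ℕ) => g 0 x.1 * ∏ i, g (Fin.succ i) (x.2 i) :=
      summable_mul_of_summable_norm (f := g 0)
        (g := fun m : Fin n → ℕ => ∏ i, g (Fin.succ i) (m i))
        (h 0).summable.norm h1.summable.norm
    have h2 := (h 0).mul h1 hs
    rw [← (Fin.consEquiv fun _ => ℕ).hasSum_iff, Fin.prod_univ_succ]
    have e : (fun m : Fin (n + 1) → ℕ => ∏ i, g i (m i)) ∘ (Fin.consEquiv fun _ => ℕ) =
        fun x : ℕ × (Fin n → ℕ) => g 0 x.1 * ∏ i, g (Fin.succ i) (x.2 i) := by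
      ext x
      simp [Fin.prod_univ_succ, Fin.consEquiv]
    rw [e]
    exact h2

lemma hasSum_pi_prod {ι : Type*} [Fintype ι] (g : ι → ℕ → ℝ) (a : ι → ℝ)
    (h : ∀ i, HasSum (g i) (a i)) :
    HasSum (fun m : ι → ℕ => ∏ i, g i (m i)) (∏ i, a i) := by
  let e := Fintype.equivFin ι
  have h1 := hasSum_fin_prod (fun i => g (e.symm i)) (fun i => a (e.symm i)) fun i => h _
  rw [← (Equiv.arrowCongr e (Equiv.refl ℕ)).hasSum_iff] at h1
  rw [Equiv.prod_comp e.symm a] at h1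
  convert! h1 using 1
  ext m
  rw [Function.comp_apply, ← Equiv.prod_comp e.symm]
  rfl

lemma coeff_prod_univ {ι : Type*} [Fintype ι] [DecidableEq ι] (f : ι → ℝ⟦X⟧) (k : ℕ) :
    coeff k (∏ i, f i) = ∑ κ ∈ Finset.piAntidiag Finset.univ k, ∏ i, coeff (κ i) (f i) := by
  rw [coeff_prod]
  refine Finset.sum_bij' (fun κ _ => (κ : ι → ℕ)) (fun κ _ => Finsupp.equivFunOnFinite.symm κ)
    ?_ ?_ ?_ ?_ ?_
  · intro κ hκ; simp_all
  · intro κ hκ; simp_all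
  · intro κ _; ext; rfl
  · intro κ _; rfl
  · intro κ _; rfl

/-- `1 / (2 j + 1) ^ 2`. -/
noncomputable def oddInvSq (j : ℕ) : ℝ := 1 / (2 * (j : ℝ) + 1) ^ 2

lemma oddInvSq_pow (j k : ℕ) : oddInvSq j ^ k = 1 / (2 * (j : ℝ) + 1) ^ (2 * k) := by
  rw [oddInvSq, div_pow, one_pow, pow_mul]

lemma hasSum_oddInvSq_pow {k : ℕ} (hk : k ≠ 0) :
    HasSum (fun j => oddInvSq j ^ k) (singleT (2 * k)) := by
  simp only [oddInvSq_pow]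
  rw [singleT_eq_tsum (by omega)]
  exact (summable_odd (by omega)).hasSum

/-- The vanishing constant term is essential: at k = 0 the powers are all 1 and their sum diverges.
-/
lemma hasSum_coeff_mul_oddInvSq_pow {U : ℝ⟦X⟧} (hU : coeff 0 U = 0) (k : ℕ) :
    HasSum (fun j => oddInvSq j ^ k * coeff k U)
      (coeff k (hadamard (fun k => singleT (2 * k)) U)) := by
  rw [coeff_hadamard]
  rcases eq_or_ne k 0 with rfl | hk
  · simp [hU]
  · rw [mul_comm]
    exact (hasSum_oddInvSq_pow hk).mul_right _

/-- Summing `[X ^ k] ∏ U_c(w_{m_c} X)` over all `m`. -/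
lemma hasSum_coeff_prod_rescale {C : Type*} [Fintype C] (U : C → ℝ⟦X⟧)
    (hU : ∀ c, coeff 0 (U c) = 0) (k : ℕ) :
    HasSum (fun m : C → ℕ => coeff k (∏ c, rescale (oddInvSq (m c)) (U c)))
      (coeff k (∏ c, hadamard (fun k => singleT (2 * k)) (U c))) := by
  classical
  simp only [coeff_prod_univ, coeff_rescale]
  refine hasSum_sum fun κ _ => ?_
  exact hasSum_pi_prod (fun c j => oddInvSq j ^ κ c * coeff (κ c) (U c))
    (fun c => coeff (κ c) (hadamard (fun k => singleT (2 * k)) (U c)))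
    fun c => hasSum_coeff_mul_oddInvSq_pow (hU c) _

end Products

/-! ### The weighted sums as sums over tuples, expanded by monomials of f. -/

section Weighted

open scoped Classical

lemma mem_indexSet {n k : ℕ} {κ : Fin n → ℕ} :
    κ ∈ indexSet k n ↔ ∑ i, κ i = k ∧ ∀ i, 0 < κ i := by
  simp [indexSet]

/-- The contribution of the tuple of odd numbers `2 m_i + 1` to the weighted sum. -/
noncomputable def weightTerm {n : ℕ} (f : MvPolynomial (Fin n) ℚ) (k : ℕ) (m : Fin n → ℕ) : ℝ :=
  ∑ κ ∈ indexSet k n, ((MvPolynomial.eval (fun i => (κ i : ℚ)) f : ℚ) : ℝ) *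
    ∏ i, oddInvSq (m i) ^ κ i

lemma summable_prod_oddInvSq {n k : ℕ} {κ : Fin n → ℕ} (hκ : κ ∈ indexSet k n) :
    Summable fun m : Fin n → ℕ => ∏ i, oddInvSq (m i) ^ κ i :=
  (hasSum_pi_prod (fun i j => oddInvSq j ^ κ i) (fun i => singleT (2 * κ i)) fun i =>
    hasSum_oddInvSq_pow ((mem_indexSet.1 hκ).2 i).ne').summable

lemma summable_weightTerm {n : ℕ} (f : MvPolynomial (Fin n) ℚ) (k : ℕ) :
    Summable (weightTerm f k) :=
  summable_sum fun _ hκ => (summable_prod_oddInvSq hκ).mul_left _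

lemma weightTerm_comp_perm {n : ℕ} {f : MvPolynomial (Fin n) ℚ} (hf : f.IsSymmetric) (k : ℕ)
    (σ : Equiv.Perm (Fin n)) (m : Fin n → ℕ) : weightTerm f k (m ∘ σ) = weightTerm f k m := by
  rw [weightTerm, weightTerm]
  refine Finset.sum_bij' (fun κ _ => κ ∘ σ.symm) (fun κ _ => κ ∘ σ) ?_ ?_ ?_ ?_ ?_
  · intro κ hκ
    rw [mem_indexSet] at hκ ⊢
    exact ⟨by rw [← hκ.1]; exact Equiv.sum_comp σ.symm κ, fun i => hκ.2 _⟩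
  · intro κ hκ
    rw [mem_indexSet] at hκ ⊢
    exact ⟨by rw [← hκ.1]; exact Equiv.sum_comp σ κ, fun i => hκ.2 _⟩
  · intro κ _; ext i; simp
  · intro κ _; ext i; simp
  · intro κ _
    congr 1
    · conv_lhs => rw [← hf σ.symm, MvPolynomial.eval_rename]
      rfl
    · rw [← Equiv.prod_comp σ.symm]
      simp

lemma tsum_odd_eq {n : ℕ} (P : (Fin n → ℕ) → Prop) [DecidablePred P]
    (hP : ∀ j : Fin n → ℕ, P (fun i => 2 * j i + 1) ↔ P j) (κ : Fin n → ℕ) :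
    ∑' m : {m : Fin n → ℕ // P m ∧ ∀ i, Odd (m i)}, ∏ i, 1 / (m.1 i : ℝ) ^ (2 * κ i) =
      ∑' j : Fin n → ℕ, if P j then ∏ i, oddInvSq (j i) ^ κ i else 0 := by
  rw [tsum_subtype_eq_tsum_ite (fun m : Fin n → ℕ => P m ∧ ∀ i, Odd (m i))
    fun m => ∏ i, 1 / (m i : ℝ) ^ (2 * κ i)]
  have hinj : Function.Injective fun (j : Fin n → ℕ) (i : Fin n) => 2 * j i + 1 := by
    intro a b hab
    ext i
    have := congrFun hab i
    simp only at this
    omega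
  rw [← hinj.tsum_eq]
  · refine tsum_congr fun j => ?_
    have : (P (fun i => 2 * j i + 1) ∧ ∀ i, Odd (2 * j i + 1)) ↔ P j := by
      rw [hP]; exact and_iff_left fun i => ⟨j i, rfl⟩
    simp only [this, oddInvSq_pow]
    push_cast
    rfl
  · intro m hm
    by_cases h : P m ∧ ∀ i, Odd (m i)
    · choose j hj using h.2
      exact ⟨j, funext fun i => (hj i).symm⟩
    · simp [h] at hm

lemma sum_tsum_eq_tsum_weightTerm {n : ℕ} (f : MvPolynomial (Fin n) ℚ) (k : ℕ)
    (P : (Fin n → ℕ) → Prop) [DecidablePred P] :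
    ∑ κ ∈ indexSet k n, ((MvPolynomial.eval (fun i => (κ i : ℚ)) f : ℚ) : ℝ) *
        ∑' j : Fin n → ℕ, (if P j then ∏ i, oddInvSq (j i) ^ κ i else 0) =
      ∑' m, if P m then weightTerm f k m else 0 := by
  have h1 : ∀ κ ∈ indexSet k n, Summable fun j : Fin n → ℕ =>
      ((MvPolynomial.eval (fun i => (κ i : ℚ)) f : ℚ) : ℝ) *
        (if P j then ∏ i, oddInvSq (j i) ^ κ i else 0) := fun κ hκ => by
    refine Summable.mul_left _ ?_
    exact (summable_ite (summable_prod_oddInvSq hκ) P 1).congr fun m => by split_ifs <;> simp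
  simp only [← tsum_mul_left]
  rw [← Summable.tsum_finsetSum h1]
  refine tsum_congr fun m => ?_
  split_ifs <;> simp [weightTerm]

lemma weightedT_eq_tsum {n : ℕ} (f : MvPolynomial (Fin n) ℚ) (k : ℕ) :
    weightedT f 2 k = ∑' m, if StrictAnti m then weightTerm f k m else 0 := by
  rw [← sum_tsum_eq_tsum_weightTerm, weightedT]
  refine Finset.sum_congr rfl fun κ _ => ?_
  rw [multipleT, tsum_odd_eq StrictAnti]
  intro j
  simp only [StrictAnti]
  refine forall₃_congr fun a b _ => ?_
  omega

lemma weightedTStar_eq_tsum {n : ℕ} (f : MvPolynomial (Fin n) ℚ) (k : ℕ) :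
    weightedTStar f 2 k = ∑' m, if Antitone m then weightTerm f k m else 0 := by
  rw [← sum_tsum_eq_tsum_weightTerm, weightedTStar]
  refine Finset.sum_congr rfl fun κ _ => ?_
  rw [multipleTStar, tsum_odd_eq Antitone]
  intro j
  simp only [Antitone]
  refine forall₃_congr fun a b _ => ?_
  omega

lemma weightTerm_eq_sum_coeff {n : ℕ} (f : MvPolynomial (Fin n) ℚ) (k : ℕ) (m : Fin n → ℕ) :
    weightTerm f k m = ∑ d ∈ f.support, ((f.coeff d : ℚ) : ℝ) *
      coeff k (∏ i, rescale (oddInvSq (m i)) (powSeries (d i))) := by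
  simp only [coeff_prod_univ, coeff_rescale, coeff_powSeries, weightTerm, MvPolynomial.eval_eq',
    Rat.cast_sum, Finset.sum_mul, Rat.cast_mul, Rat.cast_prod, Rat.cast_pow, Rat.cast_natCast]
  rw [Finset.sum_comm]
  refine Finset.sum_congr rfl fun d _ => ?_
  rw [Finset.mul_sum, indexSet, Finset.sum_filter]
  refine Finset.sum_congr rfl fun κ _ => ?_
  split_ifs with h
  · rw [mul_assoc, ← Finset.prod_mul_distrib]
    congr 1
    refine Finset.prod_congr rfl fun i _ => ?_
    rw [if_neg (h i).ne', mul_comm]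
  -- Tuples κ with a zero entry are absent from the index set, and they drop out of the coefficient
  -- because `powSeries` has no constant term.
  · push Not at h
    obtain ⟨i, hi⟩ := h
    rw [Finset.prod_eq_zero (Finset.mem_univ i), mul_zero]
    rw [if_pos (Nat.le_zero.1 hi), mul_zero]

lemma tsum_fixed_weightTerm {n : ℕ} (f : MvPolynomial (Fin n) ℚ) (k : ℕ) {C : Type} [Fintype C]
    {π : Fin n → C} (hπ : Function.Surjective π) :
    ∑' m' : C → ℕ, weightTerm f k (m' ∘ π) = ∑ d ∈ f.support, ((f.coeff d : ℚ) : ℝ) *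
      coeff k (∏ c, hadamard (fun k => singleT (2 * k))
        (∏ i with π i = c, powSeries (d i))) := by
  simp only [weightTerm_eq_sum_coeff]
  refine (hasSum_sum fun d _ => HasSum.mul_left _ ?_).tsum_eq
  have h := hasSum_coeff_prod_rescale (fun c => ∏ i with π i = c, powSeries (d i)) (fun c => ?_) k
  · convert! h using 1
    ext m'
    rw [← Finset.prod_fiberwise Finset.univ π]
    congr 1
    refine Finset.prod_congr rfl fun c _ => ?_
    rw [map_prod]
    refine Finset.prod_congr rfl fun i hi => ?_
    rw [← (Finset.mem_filter.1 hi).2, Function.comp_apply]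
  · obtain ⟨i, rfl⟩ := hπ c
    rw [coeff_zero_eq_constantCoeff_apply, map_prod]
    refine Finset.prod_eq_zero (i := i) (by simp) ?_
    rw [← coeff_zero_eq_constantCoeff_apply, coeff_powSeries, if_pos rfl]

end Weighted

/-! ### Reading off coefficients in terms of ζ(2l) t(2k - 2l). -/

section ZetaSums

/-- The real number `ζ(2l)`. -/
noncomputable def zetaEven (l : ℕ) : ℝ := (riemannZeta (2 * (l : ℂ))).re

/-- Nonvanishing of c allows π^(2l) to be expressed through ζ(2l); it holds as ζ(0) = -1/2 and ζ has
no zeros with real part at least 1. -/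
lemma exists_zeta_eq (l : ℕ) :
    ∃ c : ℚ, c ≠ 0 ∧ riemannZeta (2 * (l : ℂ)) = (((c : ℝ) * Real.pi ^ (2 * l) : ℝ) : ℂ) := by
  have hne : riemannZeta (2 * (l : ℂ)) ≠ 0 := by
    rcases eq_or_ne l 0 with rfl | hl
    · simp [riemannZeta_zero]
    · apply riemannZeta_ne_zero_of_one_le_re
      have : (1 : ℝ) ≤ l := by exact_mod_cast Nat.one_le_iff_ne_zero.2 hl
      simp
      linarith
  have h : riemannZeta (2 * (l : ℂ)) =
      ((((((-1) ^ (l + 1) * (2 : ℚ) ^ (2 * l - 1 : ℤ) * bernoulli (2 * l) /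
        (2 * l).factorial : ℚ)) : ℝ) * Real.pi ^ (2 * l) : ℝ) : ℂ) := by
    rw [riemannZeta_two_mul_nat']
    push_cast
    ring
  refine ⟨_, ?_, h⟩
  rintro h0
  rw [h0] at h
  simp [h] at hne

lemma zetaEven_cast (l : ℕ) : ((zetaEven l : ℝ) : ℂ) = riemannZeta (2 * (l : ℂ)) := by
  obtain ⟨c, -, h⟩ := exists_zeta_eq l
  rw [zetaEven, h, Complex.ofReal_re]

lemma exists_pi_pow_eq (l : ℕ) : ∃ q : ℚ, (Real.pi ^ 2 / 16) ^ l = q * zetaEven l := by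
  obtain ⟨c, hc, h⟩ := exists_zeta_eq l
  refine ⟨(c * 16 ^ l)⁻¹, ?_⟩
  rw [zetaEven, h, Complex.ofReal_re, div_pow, ← pow_mul]
  have : (c : ℝ) ≠ 0 := by exact_mod_cast hc
  push_cast
  field_simp

/-- The polynomial `∏_{i = 1}^m (x - i / 2)`. -/
noncomputable def eulerPoly : ℕ → Polynomial ℚ
  | 0 => 1
  | m + 1 => (Polynomial.X - Polynomial.C (((m : ℚ) + 1) / 2)) * eulerPoly m

lemma natDegree_eulerPoly_le (m : ℕ) : (eulerPoly m).natDegree ≤ m := by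
  induction m with
  | zero => simp [eulerPoly]
  | succ m ih =>
    rw [eulerPoly]
    refine Polynomial.natDegree_mul_le.trans ?_
    rw [Polynomial.natDegree_X_sub_C]
    omega

lemma coeff_eulerSeq (m k : ℕ) :
    coeff k (eulerSeq m) = ((eulerPoly m).eval (k : ℚ) : ℚ) * singleT (2 * k) := by
  induction m with
  | zero => simp [eulerSeq, eulerPoly, coeff_tSeries]
  | succ m ih =>
    rw [eulerSeq, eulerPoly, map_sub, coeff_eulerOp, map_rat_smul (coeff (R := ℝ) k), ih,
      Rat.smul_def]
    simp only [Polynomial.eval_mul, Polynomial.eval_sub, Polynomial.eval_X, Polynomial.eval_C]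
    push_cast
    ring

/-- The power series whose coefficients of index `k ≥ n` have the form
`∑_{l ≤ min(T, k)} c_l(k) ζ(2l) t(2k - 2l)` with rational polynomials `c_l` of degree at most
`N - 2l - 1`. -/
noncomputable def zetaSums (N n T : ℕ) : Submodule ℚ ℝ⟦X⟧ where
  carrier := {F | ∃ c : ℕ → Polynomial ℚ, (∀ l, (c l).natDegree ≤ N - 2 * l - 1) ∧
    ∀ k, n ≤ k → coeff k F = ∑ l ∈ Finset.range (min T k + 1),
      (((c l).eval (k : ℚ) : ℚ) : ℝ) * zetaEven l * singleT (2 * k - 2 * l)}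
  zero_mem' := ⟨0, by simp, by simp⟩
  add_mem' := by
    rintro F G ⟨c, hc, hF⟩ ⟨d, hd, hG⟩
    refine ⟨c + d, fun l => Polynomial.natDegree_add_le_of_degree_le (hc l) (hd l), fun k hk => ?_⟩
    rw [map_add, hF k hk, hG k hk, ← Finset.sum_add_distrib]
    refine Finset.sum_congr rfl fun l _ => ?_
    rw [Pi.add_apply, Polynomial.eval_add]
    push_cast
    ring
  smul_mem' := by
    rintro a F ⟨c, hc, hF⟩
    refine ⟨a • c, fun l => (Polynomial.natDegree_smul_le _ _).trans (hc l), fun k hk => ?_⟩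
    rw [map_rat_smul (coeff (R := ℝ) k), hF k hk, Rat.smul_def, Finset.mul_sum]
    refine Finset.sum_congr rfl fun l _ => ?_
    rw [Pi.smul_apply, Polynomial.eval_smul, smul_eq_mul]
    push_cast
    ring

lemma coeff_piX_pow_mul (l k : ℕ) (f : ℝ⟦X⟧) :
    coeff k (piX ^ l * f) = if l ≤ k then (Real.pi ^ 2 / 16) ^ l * coeff (k - l) f else 0 := by
  rw [piX, mul_pow, ← map_pow, mul_assoc, coeff_C_mul, coeff_X_pow_mul']
  split_ifs <;> simp

lemma piX_pow_mul_eulerSeq_mem {N n T l m : ℕ} (hl : l ≤ T) (h : 2 * l + m + 1 ≤ N) :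
    piX ^ l * eulerSeq m ∈ zetaSums N n T := by
  obtain ⟨q, hq⟩ := exists_pi_pow_eq l
  refine ⟨fun j => if j = l then
    Polynomial.C q * (eulerPoly m).comp (Polynomial.X - Polynomial.C (l : ℚ)) else 0, ?_, ?_⟩
  · intro j
    dsimp only
    split_ifs with hj
    · subst hj
      refine (Polynomial.natDegree_C_mul_le _ _).trans (Polynomial.natDegree_comp_le.trans ?_)
      rw [Polynomial.natDegree_X_sub_C, mul_one]
      exact (natDegree_eulerPoly_le m).trans (by omega)
    · simp
  · intro k _
    rw [coeff_piX_pow_mul]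
    split_ifs with hlk
    · rw [Finset.sum_eq_single_of_mem l (Finset.mem_range.2 (by omega))]
      · dsimp only
        rw [if_pos rfl, hq, coeff_eulerSeq, Nat.mul_sub]
        simp only [Polynomial.eval_mul, Polynomial.eval_C, Polynomial.eval_comp,
          Polynomial.eval_sub, Polynomial.eval_X, Nat.cast_sub hlk]
        push_cast
        ring
      · intro j _ hj
        simp [hj]
    · refine (Finset.sum_eq_zero fun j hj => ?_).symm
      rw [Finset.mem_range] at hj
      have hjl : j ≠ l := by omega
      simp [hjl]

lemma secSpan_le_zetaSums {N n T : ℕ} (hT : N ≤ 2 * T + 3) : secSpan N ≤ zetaSums N n T := by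
  refine (secSpan_le_derivedSpan N).trans (span_le.2 ?_)
  rintro f ⟨l, m, hm, h, rfl⟩
  exact piX_pow_mul_eulerSeq_mem (by omega) h

lemma tSeries_pow_mem_zetaSums {N n T q : ℕ} (hT : N ≤ 2 * T + 3) (hT' : n ≤ 2 * T + 2)
    (hn : n ≤ N) (hq : 1 ≤ q) (hqn : q ≤ n) : tSeries ^ q ∈ zetaSums N n T := by
  have h1 := secSpan_le_zetaSums (n := n) hT
    (secSpan_mono (hqn.trans hn) (tSeries_pow_sub_mem q))
  rw [← sub_add_cancel (tSeries ^ q)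
    ((-1 : ℚ) ^ (q / 2) • (piX ^ (q / 2) * tSeries ^ (q % 2)))]
  refine add_mem h1 (smul_mem _ _ ?_)
  rcases Nat.mod_two_eq_zero_or_one q with h | h
  -- For even q the remainder Y^(q/2) is a single power of X with exponent below n, invisible in the
  -- coefficients with k ≥ n.
  · refine ⟨0, by simp, fun k hk => ?_⟩
    rw [h, coeff_piX_pow_mul, pow_zero, coeff_one, if_pos (by omega), if_neg (by omega)]
    simp
  · rw [h, pow_one]
    exact piX_pow_mul_eulerSeq_mem (m := 0) (by omega) (by omega)

lemma prod_hadamard_mem_zetaSums {N n T : ℕ} (hT : N ≤ 2 * T + 3) (hT' : n ≤ 2 * T + 2)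
    (hn : n ≤ N) (hn1 : 1 ≤ n) {C : Type} [Fintype C] [DecidableEq C]
    {π : Fin n → C} (hπ : Function.Surjective π) (d : Fin n → ℕ) (hd : ∑ i, (d i + 1) ≤ N) :
    ∏ c, hadamard (fun k => singleT (2 * k)) (∏ i with π i = c, powSeries (d i)) ∈
      zetaSums N n T := by
  have hne : ∀ c, (Finset.univ.filter fun i => π i = c).Nonempty := fun c => by
    obtain ⟨i, rfl⟩ := hπ c
    exact ⟨i, by simp⟩
  obtain ⟨α, h, hh, e⟩ := prod_hadamard_mem Finset.univ
    (fun c => ∑ i with π i = c, (d i + 1)) (fun c _ => by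
      obtain ⟨i, hi⟩ := hne c
      exact (Nat.le_add_left 1 (d i)).trans
        (Finset.single_le_sum (f := fun i => d i + 1) (fun _ _ => Nat.zero_le _) hi))
    (fun c => ∏ i with π i = c, powSeries (d i))
    (fun c _ => prod_powSeries_mem _ (hne c) _)
  rw [Finset.sum_fiberwise] at hh
  rw [e]
  have hcard : Fintype.card C ≤ n := by simpa using Fintype.card_le_of_surjective π hπ
  have hpos : 1 ≤ Fintype.card C := Fintype.card_pos_iff.2 ⟨π ⟨0, hn1⟩⟩
  exact add_mem (smul_mem _ _ (tSeries_pow_mem_zetaSums hT hT' hn hpos hcard))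
    (secSpan_le_zetaSums hT (secSpan_mono hd hh))

open scoped Classical in
lemma symmetrized_sum_mem_zetaSums {n T : ℕ} (hn1 : 1 ≤ n) {f : MvPolynomial (Fin n) ℚ}
    (hf : f.IsSymmetric) (hT : f.totalDegree + n ≤ 2 * T + 3) (hT' : n ≤ 2 * T + 2)
    (P : (Fin n → ℕ) → Prop) [DecidablePred P] (χ : Equiv.Perm (Fin n) → ℚ)
    (hP : ∀ m, ∑ σ : Equiv.Perm (Fin n), (if P (m ∘ σ) then (1 : ℝ) else 0) =
      ∑ σ : Equiv.Perm (Fin n), if m ∘ σ = m then (χ σ : ℝ) else 0) :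
    PowerSeries.mk (fun k => ∑' m, if P m then weightTerm f k m else 0) ∈
      zetaSums (f.totalDegree + n) n T := by
  have hfac : (n.factorial : ℚ) ≠ 0 := by positivity
  rw [← Submodule.smul_mem_iff _ hfac]
  have key : ∀ σ : Equiv.Perm (Fin n),
      PowerSeries.mk (fun k => ∑' m : Fin n → ℕ, if m ∘ σ = m then weightTerm f k m else 0) ∈
        zetaSums (f.totalDegree + n) n T := by
    intro σ
    obtain ⟨C, hC, π, hπ, hfix⟩ := exists_cycle_quotient σ
    have : PowerSeries.mk
        (fun k => ∑' m : Fin n → ℕ, if m ∘ σ = m then weightTerm f k m else 0) =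
        ∑ d ∈ f.support, (f.coeff d) • ∏ c, hadamard (fun k => singleT (2 * k))
          (∏ i with π i = c, powSeries (d i)) := by
      ext k
      rw [coeff_mk, tsum_fixed_eq hπ hfix, tsum_fixed_weightTerm f k hπ, map_sum]
      refine Finset.sum_congr rfl fun d _ => ?_
      rw [map_rat_smul (coeff (R := ℝ) k), Rat.smul_def]
    rw [this]
    refine sum_mem fun d hd => smul_mem _ _ ?_
    refine prod_hadamard_mem_zetaSums hT hT' (by omega) hn1 hπ _ ?_
    have := MvPolynomial.le_totalDegree hd
    rw [Finsupp.sum_fintype _ _ fun _ => rfl] at this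
    simpa [Finset.sum_add_distrib] using this
  have e : (n.factorial : ℚ) • PowerSeries.mk
      (fun k => ∑' m, if P m then weightTerm f k m else 0) =
      ∑ σ : Equiv.Perm (Fin n), χ σ • PowerSeries.mk
        (fun k => ∑' m : Fin n → ℕ, if m ∘ σ = m then weightTerm f k m else 0) := by
    ext k
    rw [map_rat_smul (coeff (R := ℝ) k), coeff_mk, map_sum, Rat.smul_def, Rat.cast_natCast,
      factorial_mul_tsum (summable_weightTerm f k) (weightTerm_comp_perm hf k) P
        (fun σ => (χ σ : ℝ)) hP]
    refine Finset.sum_congr rfl fun σ _ => ?_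
    rw [map_rat_smul (coeff (R := ℝ) k), coeff_mk, Rat.smul_def]
  rw [e]
  exact sum_mem fun σ _ => smul_mem _ _ (key σ)

end ZetaSums

end

theorem theorem1p1 (n : ℕ) (hn : 1 ≤ n) (f : MvPolynomial (Fin n) ℚ) (hf : f.IsSymmetric)
    (r : ℕ) (hr : f.totalDegree = r)
    (T : ℕ) (hT : (T : ℤ) = max (((r : ℤ) + n - 2) / 2) (((n : ℤ) - 1) / 2)) :
    ∃ c cstar : ℕ → Polynomial ℚ,
      (∀ l ≤ T,
        ((c l).natDegree : ℤ) ≤ (r : ℤ) + n - 2 * l - 1 ∧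
        ((cstar l).natDegree : ℤ) ≤ (r : ℤ) + n - 2 * l - 1) ∧
      ∀ k : ℕ, n ≤ k →
        ((weightedT f 2 k : ℝ) : ℂ) =
          ∑ l ∈ Finset.range (min T k + 1),
            (((c l).eval (k : ℚ) : ℚ) : ℂ) * riemannZeta (2 * (l : ℂ)) *
              ((singleT (2 * k - 2 * l) : ℝ) : ℂ) ∧
        ((weightedTStar f 2 k : ℝ) : ℂ) =
          ∑ l ∈ Finset.range (min T k + 1),
            (((cstar l).eval (k : ℚ) : ℚ) : ℂ) * riemannZeta (2 * (l : ℂ)) *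
              ((singleT (2 * k - 2 * l) : ℝ) : ℂ) := by
  classical
  subst hr
  have hT1 : f.totalDegree + n ≤ 2 * T + 3 := by omega
  have hT2 : n ≤ 2 * T + 2 := by omega
  obtain ⟨c, hc, h⟩ := symmetrized_sum_mem_zetaSums hn hf hT1 hT2 StrictAnti
    (fun σ => ((Equiv.Perm.sign σ : ℤ) : ℚ)) fun m => by
      have := sum_strictAnti_eq m
      simp only [Rat.cast_intCast]
      convert! this
  obtain ⟨c', hc', h'⟩ := symmetrized_sum_mem_zetaSums hn hf hT1 hT2 Antitone
    (fun _ => 1) fun m => by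
      have := sum_antitone_eq m
      simp only [Rat.cast_one]
      convert! this
  refine ⟨c, c', fun l hl => ?_, fun k hk => ⟨?_, ?_⟩⟩
  · have h1 := hc l
    have h2 := hc' l
    -- For l ≤ T the natural subtraction in the degree bound is not truncated, so it agrees with the
    -- integer bound.
    have h3 : 2 * l + 1 ≤ f.totalDegree + n := by omega
    omega
  · have h1 := h k hk
    rw [PowerSeries.coeff_mk, ← weightedT_eq_tsum] at h1
    rw [h1]
    push_cast
    simp only [zetaEven_cast]
  · have h1 := h' k hk
    rw [PowerSeries.coeff_mk, ← weightedTStar_eq_tsum] at h1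
    rw [h1]
    push_cast
    simp only [zetaEven_cast]
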